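/- Let $\mathrm{Pres}$ be the category whose objects are the presentations $c:F\twoheadrightarrow G$ ($F$ a free group, $G$ any group, $c$ an epimorphism) and whose morphisms $(\varphi,\tilde\varphi):c\to c'$ are commutative squares, $\tilde\varphi:F\to F'$, $\varphi:G\to G'$, $c'\tilde\varphi=\varphi c$. For a group $G$ let $\mathrm{Pres}(G)\subset\mathrm{Pres}$ be the subcategory of presentations of $G$ and morphisms with $\varphi=\mathrm{id}_G$. Let $\mathcal F:\mathrm{Pres}\to\mathrm{Ab}$ be a functor and $i\ge 0$. Let $\lim^i_{\mathrm{Pres}(G)}\mathcal F$ be the value on $\mathcal F|_{\mathrm{Pres}(G)}$ of the $i$-th right derived functor of $\lim:\mathrm{Ab}^{\mathrm{Pres}(G)}\to\mathrm{Ab}$ (formed in a universe of abelian groups for which the categories $\mathrm{Pres}(G)$ are small). For a presentation $c:F\twoheadrightarrow G$ let $B_G(c)$ be the cosimplicial object $[n]\mapsto \bigsqcup_{j=0}^n c=(F*\dots*F\twoheadrightarrow G)$ of $\mathrm{Pres}(G)$, in which $f:[n]\to[m]$ acts by $(i_{f(0)},\dots,i_{f(n)})$, where the $i_j$ are the canonical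 inclusions, and let $H^i\mathcal F B_G(c)$ be the $i$-th cohomology of the alternating sum complex of $\mathcal F B_G(c)$. There is a canonical isomorphism $$e_c:\ \lim{}^i_{\mathrm{Pres}(G)}\,\mathcal F\ \cong\ H^i\mathcal F B_G(c).$$ Here, if $\mathcal F|_{\mathrm{Pres}(G)}\to P^\bullet$ is an injective resolution and $T$ is the total complex of the double complex $P^q(B_G(c)^p)$, the map $H^i\mathcal F B_G(c)\to H^i(T)$ induced by $\mathcal F\to P^0$ is an isomorphism, and $e_c$ is the composite of its inverse with the map $H^i(\lim P^\bullet)\to H^i(T)$ induced by the projections $\lim P^q\to P^q(c)$. A morphism $(\varphi,\tilde\varphi):c\to c'$ of $\mathrm{Pres}$ induces a morphism of cosimplicial objects $B_G(c)\to B_{G'}(c')$ of $\mathrm{Pres}$ (it is $\tilde\varphi$ on every free factor), and hence, through $e_c$ and $e_{c'}$, a homomorphism $$\lim{}^i_{\mathrm{Pres}(G)}\,\mathcal F\ \longrightarrow\ \lim{}^i_{\mathrm{Pres}(G')}\,\mathcal F .\qquad(*)$$ **Lemma.** The homomorphism $(*)$ depends only on $\varphi:G\to G'$: it does not depend on the choice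 of the presentations $c$, $c'$ and of the lift $\tilde\varphi$. Moreover, these homomorphisms define a functor $\lim^i_{\mathrm{Pres}(G)}\mathcal F:\mathrm{Gr}\to\mathrm{Ab}$: there is exactly one functor $\mathrm{Gr}\to\mathrm{Ab}$ whose value on each group $G$ is $\lim^i_{\mathrm{Pres}(G)}\mathcal F$ and which sends $\varphi$ to $(*)$ for every morphism $(\varphi,\tilde\varphi)$ of $\mathrm{Pres}$. The groups $\lim^i_{\mathrm{Pres}(G)}\mathcal F$ are, up to isomorphism, abelian groups of the universe in which $\mathcal F$ takes its values. -/

import Mathlib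

open CategoryTheory CategoryTheory.Limits

universe w v u v₁ u₁

namespace PresLim

noncomputable section

/-! ### Presentations of groups -/

/-- A presentation of the group `G`: a free group together with an epimorphism onto `G`.
These are the objects of the category `Pres(G)`. -/
structure PresOver (G : GrpCat.{u}) where
  F : GrpCat.{u}
  π : F ⟶ G
  isFree : IsFreeGroup F
  surjective : Function.Surjective π.hom

namespace PresOver

/-- Morphisms of `Pres(G)` are the group homomorphisms over `G`. -/
@[ext]
structure Hom {G : GrpCat.{u}} (c c' : PresOver G) where
  top : c.F ⟶ c'.F
  w : top ≫ c'.π = c.π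

instance (G : GrpCat.{u}) : Category.{u} (PresOver G) where
  Hom c c' := Hom c c'
  id c := ⟨𝟙 _, by simp⟩
  comp f g := ⟨f.top ≫ g.top, by rw [Category.assoc, g.w, f.w]⟩

end PresOver

/-- A presentation `F ↠ G` of an arbitrary group `G`: an object of the category `Pres`. -/
structure Pres where
  G : GrpCat.{u}
  c : PresOver G

namespace Pres

/-- Morphisms of `Pres` are the commutative squares. -/
@[ext]
structure Hom (c c' : Pres.{u}) where
  top : c.c.F ⟶ c'.c.F
  base : c.G ⟶ c'.G
  w : top ≫ c'.c.π = c.c.π ≫ base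

instance : Category.{u} Pres.{u} where
  Hom c c' := Hom c c'
  id c := ⟨𝟙 _, 𝟙 _, by simp⟩
  comp f g := ⟨f.top ≫ g.top, f.base ≫ g.base, by
    rw [Category.assoc, g.w, ← Category.assoc, f.w, Category.assoc]⟩

end Pres

/-- The inclusion of the subcategory `Pres(G)` into `Pres`. -/
abbrev incl (G : GrpCat.{u}) : PresOver G ⥤ Pres.{u} where
  obj c := ⟨G, c⟩
  map f := ⟨f.top, 𝟙 G, by rw [Category.comp_id]; exact f.w⟩

/-! ### The standard complex -/

/-- The coproduct in `Pres(G)` of a nonempty family of copies of a presentation `c : F ↠ G`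
indexed by `J`: the free product of copies of `F`, mapped to `G` by `c` on every factor. -/
def copower {G : GrpCat.{u}} (c : PresOver G) (J : Type) [Nonempty J] : PresOver G where
  F := GrpCat.of (Monoid.CoprodI (fun _ : J => c.F))
  π := GrpCat.ofHom (Monoid.CoprodI.lift (fun _ : J => c.π.hom))
  isFree := by
    have := c.isFree
    exact inferInstanceAs (IsFreeGroup (Monoid.CoprodI (fun _ : J => c.F)))
  surjective g := by
    obtain ⟨x, hx⟩ := c.surjective g
    exact ⟨Monoid.CoprodI.of (i := Classical.arbitrary J) x, by simpa using hx⟩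

/-- The canonical inclusions `i_j` of `c` into the coproduct of copies of `c`. -/
def copowerι {G : GrpCat.{u}} (c : PresOver G) (J : Type) [Nonempty J] (j : J) :
    c ⟶ copower c J where
  top := GrpCat.ofHom (Monoid.CoprodI.of (M := fun _ : J => c.F) (i := j))
  w := by
    ext x
    simp [copower]

/-- The morphism `(g_j)_j` out of the coproduct of copies of `c` given by `g_j` on the `j`-th
copy. -/
def copowerDesc {G : GrpCat.{u}} {c d : PresOver G} {J : Type} [Nonempty J]
    (g : J → (c ⟶ d)) : copower c J ⟶ d where
  top := GrpCat.ofHom (Monoid.CoprodI.lift (fun j : J => (g j).top.hom))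
  w := by
    refine GrpCat.hom_ext (Monoid.CoprodI.ext_hom _ _ fun j => ?_)
    ext x
    have h : d.π.hom ((g j).top.hom x) = c.π.hom x := congrArg (fun t => t.hom x) (g j).w
    change d.π.hom (Monoid.CoprodI.lift (fun j : J => (g j).top.hom) (Monoid.CoprodI.of x)) =
      Monoid.CoprodI.lift (fun _ : J => c.π.hom) (Monoid.CoprodI.of x)
    simpa only [Monoid.CoprodI.lift_of] using h

theorem copowerι_desc {G : GrpCat.{u}} {c d : PresOver G} {J : Type} [Nonempty J]
    (g : J → (c ⟶ d)) (j : J) : copowerι c J j ≫ copowerDesc g = g j := by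
  refine PresOver.Hom.ext ?_
  change GrpCat.ofHom _ ≫ GrpCat.ofHom _ = _
  ext x
  simp

theorem copower_hom_ext {G : GrpCat.{u}} {c d : PresOver G} {J : Type} [Nonempty J]
    {f g : copower c J ⟶ d} (h : ∀ j, copowerι c J j ≫ f = copowerι c J j ≫ g) : f = g := by
  refine PresOver.Hom.ext (GrpCat.hom_ext (Monoid.CoprodI.ext_hom _ _ fun j => ?_))
  have := congrArg (fun t => (PresOver.Hom.top t).hom) (h j)
  exact this

/-- The standard complex of `c`: the cosimplicial object of `Pres(G)` with terms the coproducts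
of `n + 1` copies of `c`, a map `f : [n] → [m]` acting by `(i_{f(0)}, …, i_{f(n)})`. -/
def standardComplex {G : GrpCat.{u}} (c : PresOver G) : CosimplicialObject (PresOver G) where
  obj n := copower c (Fin (n.len + 1))
  map f := copowerDesc (fun j => copowerι c _ (f.toOrderHom j))
  map_id n := copower_hom_ext fun j => by
    rw [copowerι_desc, Category.comp_id]
    rfl
  map_comp f g := copower_hom_ext fun j => by
    rw [copowerι_desc, ← Category.assoc, copowerι_desc, copowerι_desc]
    rfl

/-- The morphism of cosimplicial objects of `Pres` induced by a morphism `f : c ⟶ c'` of `Pres`;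
in each degree it is `f` on every copy of `c`. -/
def standardComplexMap {G G' : GrpCat.{u}} {c : PresOver G} {c' : PresOver G'}
    (f : (incl G).obj c ⟶ (incl G').obj c') :
    standardComplex c ⋙ incl G ⟶ standardComplex c' ⋙ incl G' where
  app n :=
    { top := GrpCat.ofHom (Monoid.CoprodI.lift (fun j : Fin (n.len + 1) =>
        (Monoid.CoprodI.of (M := fun _ : Fin (n.len + 1) => c'.F) (i := j)).comp f.top.hom))
      base := f.base
      w := by
        refine GrpCat.hom_ext (Monoid.CoprodI.ext_hom _ _ fun j => ?_)
        ext x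
        have h : c'.π.hom (f.top.hom x) = f.base.hom (c.π.hom x) :=
          congrArg (fun t => t.hom x) f.w
        change Monoid.CoprodI.lift (fun _ : Fin (n.len + 1) => c'.π.hom)
            (Monoid.CoprodI.lift (fun j : Fin (n.len + 1) =>
              (Monoid.CoprodI.of (M := fun _ : Fin (n.len + 1) => c'.F) (i := j)).comp f.top.hom)
              (Monoid.CoprodI.of x)) =
          f.base.hom (Monoid.CoprodI.lift (fun _ : Fin (n.len + 1) => c.π.hom)
            (Monoid.CoprodI.of x))
        rw [Monoid.CoprodI.lift_of, Monoid.CoprodI.lift_of, MonoidHom.comp_apply,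
          Monoid.CoprodI.lift_of]
        exact h }
  naturality n m g := by
    refine Pres.Hom.ext ?_ ?_
    · refine GrpCat.hom_ext (Monoid.CoprodI.ext_hom _ _ fun j => ?_)
      ext x
      have h1 (k : ℕ) (j : Fin (k + 1)) (y : c.F) :
          Monoid.CoprodI.lift (fun j : Fin (k + 1) =>
            (Monoid.CoprodI.of (M := fun _ : Fin (k + 1) => c'.F) (i := j)).comp f.top.hom)
            (Monoid.CoprodI.of (M := fun _ : Fin (k + 1) => c.F) (i := j) y) =
          Monoid.CoprodI.of (i := j) (f.top.hom y) := by
        rw [Monoid.CoprodI.lift_of, MonoidHom.comp_apply]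
      have h2 (d : PresOver G) (y : d.F) : Monoid.CoprodI.lift
            (fun j : Fin (n.len + 1) => (copowerι d (Fin (m.len + 1)) (g.toOrderHom j)).top.hom)
            (Monoid.CoprodI.of (M := fun _ : Fin (n.len + 1) => d.F) (i := j) y) =
          Monoid.CoprodI.of (M := fun _ : Fin (m.len + 1) => d.F) (i := g.toOrderHom j) y := by
        rw [Monoid.CoprodI.lift_of]
        rfl
      have h3 (d : PresOver G') (y : d.F) : Monoid.CoprodI.lift
            (fun j : Fin (n.len + 1) => (copowerι d (Fin (m.len + 1)) (g.toOrderHom j)).top.hom)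
            (Monoid.CoprodI.of (M := fun _ : Fin (n.len + 1) => d.F) (i := j) y) =
          Monoid.CoprodI.of (M := fun _ : Fin (m.len + 1) => d.F) (i := g.toOrderHom j) y := by
        rw [Monoid.CoprodI.lift_of]
        rfl
      exact (congrArg _ (h2 c x)).trans ((h1 m.len (g.toOrderHom j) x).trans
        ((h3 c' (f.top.hom x)).symm.trans (congrArg _ (h1 n.len j x).symm)))
    · exact (Category.id_comp (X := G) (Y := G') f.base).trans
        (Category.comp_id (X := G) (Y := G') f.base).symm

/-! ### Higher limits -/

section HigherLimits

variable {C : Type u₁} [Category.{v₁} C]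

/-- Functors from `C` to abelian groups (in a universe in which `C` is small) have enough
injectives: products of functors right Kan extended from a point. -/
instance enoughInjectives_functor [UnivLE.{u₁, v}] [UnivLE.{v₁, v}] :
    EnoughInjectives (C ⥤ AddCommGrpCat.{v}) where
  presentation F := by
    let R (c : C) : C ⥤ AddCommGrpCat.{v} :=
      (evaluationRightAdjoint AddCommGrpCat.{v} c).obj (Injective.under (F.obj c))
    have hR (c : C) : Injective (R c) :=
      Injective.injective_of_adjoint (evaluationAdjunctionLeft AddCommGrpCat.{v} c) _
    let r (c : C) : F ⟶ R c :=
      (evaluationAdjunctionLeft AddCommGrpCat.{v} c).homEquiv _ _ (Injective.ι (F.obj c))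
    have hr (c : C) : Mono ((r c).app c) := by
      have h : (r c).app c ≫ (evaluationAdjunctionLeft AddCommGrpCat.{v} c).counit.app _ =
          Injective.ι (F.obj c) :=
        ((evaluationAdjunctionLeft AddCommGrpCat.{v} c).homEquiv_counit _ _ _).symm.trans
          (Equiv.symm_apply_apply _ _)
      exact mono_of_mono_fac h
    refine ⟨⟨∏ᶜ R, inferInstance, Pi.lift r, ?_⟩⟩
    have (c : C) : Mono ((Pi.lift r).app c) := by
      have h : (Pi.lift r).app c ≫ (Pi.π R c).app c = (r c).app c := by
        rw [← NatTrans.comp_app, Pi.lift_π]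
      have := hr c
      exact mono_of_mono_fac h
    exact NatTrans.mono_of_mono_app _

instance lim_additive [HasLimitsOfShape C AddCommGrpCat.{v}] :
    (lim : (C ⥤ AddCommGrpCat.{v}) ⥤ AddCommGrpCat.{v}).Additive where
  map_add {F G f g} := by
    refine limit.hom_ext fun j => ?_
    simp [Preadditive.add_comp, Preadditive.comp_add]

variable [HasLimitsOfShape C AddCommGrpCat.{v}] [HasInjectiveResolutions (C ⥤ AddCommGrpCat.{v})]

/-- The higher limit `lim^n F`: the `n`-th right derived functor of the limit functor. -/
abbrev higherLim (F : C ⥤ AddCommGrpCat.{v}) (n : ℕ) : AddCommGrpCat.{v} :=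
  ((lim : (C ⥤ AddCommGrpCat.{v}) ⥤ AddCommGrpCat.{v}).rightDerived n).obj F

end HigherLimits

/-! ### Comparison of higher limits with the cohomology of a cosimplicial object -/

section Total

/-- The sign rule for the total complex of a double complex indexed by `ℕ × ℕ`. -/
instance tensorSigns_upNat : (ComplexShape.up ℕ).TensorSigns where
  ε' := MonoidHom.mk' (fun (i : Multiplicative ℕ) => (-1 : ℤˣ) ^ (i.toAdd)) (by
    intro a b
    exact pow_add _ _ _)
  rel_add p q r (hpq : p + 1 = q) := by
    change _ + 1 = _
    omega
  add_rel p q r (hpq : p + 1 = q) := by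
    change _ + 1 = _
    omega
  ε'_succ := by
    rintro p q rfl
    exact (pow_succ _ _).trans (mul_neg_one _)

variable (K : HomologicalComplex₂ AddCommGrpCat.{v} (.up ℕ) (.up ℕ))

/-- A morphism to the subcomplex of bidegrees `(0, p)` of a double complex that is killed by the
differential raising the first degree gives a morphism to the total complex. -/
def rowToTotal (A : CochainComplex AddCommGrpCat.{v} ℕ) (φ : A ⟶ K.X 0) (h : φ ≫ K.d 0 1 = 0) :
    A ⟶ K.total (.up ℕ) where
  f p := φ.f p ≫ K.ιTotal (.up ℕ) 0 p p (zero_add p)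
  comm' := by
    rintro p _ rfl
    have h0 : φ.f p ≫ (K.d 0 1).f p = 0 := by
      rw [← HomologicalComplex.comp_f, h, HomologicalComplex.zero_f]
    have e1 : K.d₁ (.up ℕ) 0 p (p + 1) =
        (K.d 0 1).f p ≫ K.ιTotal (.up ℕ) 1 p (p + 1) (add_comm 1 p) := by
      rw [K.d₁_eq (.up ℕ) (show (ComplexShape.up ℕ).Rel 0 1 from rfl) p (p + 1) (add_comm 1 p)]
      exact one_smul _ _
    have e2 : K.d₂ (.up ℕ) 0 p (p + 1) =
        (K.X 0).d p (p + 1) ≫ K.ιTotal (.up ℕ) 0 (p + 1) (p + 1) (zero_add _) := by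
      rw [K.d₂_eq (.up ℕ) 0 (show (ComplexShape.up ℕ).Rel p (p + 1) from rfl) (p + 1)
        (zero_add _)]
      exact one_smul _ _
    change (_ ≫ _) ≫ (K.D₁ _ _ _ + K.D₂ _ _ _) = _
    rw [Category.assoc, Preadditive.comp_add, K.ι_D₁, K.ι_D₂, e1, e2, Preadditive.comp_add,
      ← Category.assoc, h0, zero_comp, zero_add, ← Category.assoc, φ.comm, Category.assoc]

/-- A morphism to the subcomplex of bidegrees `(q, 0)` of a double complex that is killed by the
differential raising the second degree gives a morphism to the total complex. -/
def colToTotal (L : CochainComplex AddCommGrpCat.{v} ℕ) (ψ : ∀ q, L.X q ⟶ (K.X q).X 0)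
    (hψ : ∀ q, ψ q ≫ (K.d q (q + 1)).f 0 = L.d q (q + 1) ≫ ψ (q + 1))
    (h : ∀ q, ψ q ≫ (K.X q).d 0 1 = 0) :
    L ⟶ K.total (.up ℕ) where
  f q := ψ q ≫ K.ιTotal (.up ℕ) q 0 q (add_zero q)
  comm' := by
    rintro q _ rfl
    have e1 : K.d₁ (.up ℕ) q 0 (q + 1) =
        (K.d q (q + 1)).f 0 ≫ K.ιTotal (.up ℕ) (q + 1) 0 (q + 1) (add_zero _) := by
      rw [K.d₁_eq (.up ℕ) (show (ComplexShape.up ℕ).Rel q (q + 1) from rfl) 0 (q + 1)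
        (add_zero _)]
      exact one_smul _ _
    have e2 : ψ q ≫ K.d₂ (.up ℕ) q 0 (q + 1) = 0 := by
      rw [K.d₂_eq (.up ℕ) q (show (ComplexShape.up ℕ).Rel 0 1 from rfl) (q + 1) rfl,
        Linear.comp_units_smul, ← Category.assoc, h, zero_comp, smul_zero]
    change (_ ≫ _) ≫ (K.D₁ _ _ _ + K.D₂ _ _ _) = _
    rw [Category.assoc, Preadditive.comp_add, K.ι_D₁, K.ι_D₂, Preadditive.comp_add, e2, add_zero,
      e1, ← Category.assoc, hψ, Category.assoc]

end Total

section Comparison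

variable {C : Type u₁} [Category.{v₁} C] (X : CosimplicialObject C)

/-- For a cosimplicial object `X` of `C`, the functor that sends `F : C ⥤ Ab` to the alternate sum
complex of the cosimplicial abelian group `F X`. -/
abbrev evalComplex : (C ⥤ AddCommGrpCat.{v}) ⥤ CochainComplex AddCommGrpCat.{v} ℕ :=
  (Functor.whiskeringLeft SimplexCategory C AddCommGrpCat.{v}).obj X ⋙
    AlgebraicTopology.alternatingCofaceMapComplex AddCommGrpCat.{v}

instance evalComplex_additive : (evalComplex.{v} X).Additive where
  map_add {F G f g} := by
    ext n : 1
    rfl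

/-- The cohomotopy group `π^n(F X)`: the cohomology of the alternate sum complex of `F X`. -/
abbrev cohomotopy (F : C ⥤ AddCommGrpCat.{v}) (n : ℕ) : AddCommGrpCat.{v} :=
  ((evalComplex X).obj F).homology n

/-- The double complex `P^q (X^p)` attached to a cochain complex `P` of functors: the differential
in the direction of `q` is that of `P`, the one in the direction of `p` is the alternate sum of the
cofaces. -/
abbrev doubleComplex (P : CochainComplex (C ⥤ AddCommGrpCat.{v}) ℕ) :
    HomologicalComplex₂ AddCommGrpCat.{v} (.up ℕ) (.up ℕ) :=
  ((evalComplex X).mapHomologicalComplex (.up ℕ)).obj P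

/-- The total complex of `P^q (X^p)`. -/
abbrev totalComplex (P : CochainComplex (C ⥤ AddCommGrpCat.{v}) ℕ) :
    CochainComplex AddCommGrpCat.{v} ℕ :=
  (doubleComplex X P).total (.up ℕ)

section

variable (F : C ⥤ AddCommGrpCat.{v}) (P : InjectiveResolution F)

theorem alternatingCoface_d_zero (Y : CosimplicialObject AddCommGrpCat.{v}) :
    ((AlgebraicTopology.alternatingCofaceMapComplex AddCommGrpCat.{v}).obj Y).d 0 1 =
      Y.δ 0 - Y.δ 1 := by
  refine (CochainComplex.of_d (fun n => Y.obj (SimplexCategory.mk n))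
    (AlgebraicTopology.AlternatingCofaceMapComplex.objD Y) 0).trans ?_
  simp [Fin.sum_univ_two]
  exact (sub_eq_add_neg _ _).symm

variable {F} in
/-- The coaugmentation `F ⟶ P^0` of an injective resolution. -/
def coaug : F ⟶ P.cocomplex.X 0 := P.ι.f 0

variable {F} in
theorem coaug_comp_d : coaug P ≫ P.cocomplex.d 0 1 = 0 := P.ι_f_zero_comp_complex_d

/-- The morphism from the alternate sum complex of `F X` to the total complex of `P^q (X^p)`
induced by the coaugmentation `F ⟶ P^0` of an injective resolution `P` of `F`. -/
def resToTotal : (evalComplex X).obj F ⟶ totalComplex X P.cocomplex :=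
  rowToTotal _ _ ((evalComplex X).map (coaug P)) (by
    change (evalComplex X).map (coaug P) ≫ (evalComplex X).map (P.cocomplex.d 0 1) = 0
    rw [← Functor.map_comp, coaug_comp_d, Functor.map_zero])

/-- The morphism from the complex `lim P` to the total complex of `P^q (X^p)` induced by the
projections `lim P^q ⟶ P^q (X^0)`. -/
def limToTotal [HasLimitsOfShape C AddCommGrpCat.{v}] :
    ((lim : (C ⥤ AddCommGrpCat.{v}) ⥤ AddCommGrpCat.{v}).mapHomologicalComplex (.up ℕ)).obj
      P.cocomplex ⟶ totalComplex X P.cocomplex :=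
  colToTotal _ _ (fun q => limit.π (P.cocomplex.X q) (X.obj (SimplexCategory.mk 0)))
    (fun q => (limMap_π (P.cocomplex.d q (q + 1)) _).symm)
    (fun q => by
      have hd : ((evalComplex X).obj (P.cocomplex.X q)).d 0 1 =
          (P.cocomplex.X q).map (X.δ 0) - (P.cocomplex.X q).map (X.δ 1) :=
        alternatingCoface_d_zero (X ⋙ P.cocomplex.X q)
      change limit.π _ _ ≫ ((evalComplex X).obj (P.cocomplex.X q)).d 0 1 = 0
      rw [hd]
      refine (Preadditive.comp_sub _ _ _).trans (sub_eq_zero.mpr ?_)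
      exact (limit.w (P.cocomplex.X q) (X.δ 0)).trans (limit.w (P.cocomplex.X q) (X.δ 1)).symm)

end

variable (F : C ⥤ AddCommGrpCat.{v}) [HasInjectiveResolutions (C ⥤ AddCommGrpCat.{v})]

/-- The cohomology `H^n` of the total complex of `P^q (X^p)`, where `P` is an injective resolution
of `F`. -/
abbrev totalCohomology (n : ℕ) : AddCommGrpCat.{v} :=
  (totalComplex X (injectiveResolution F).cocomplex).homology n

/-- The map `π^n (F X) ⟶ H^n` induced by the coaugmentation `F ⟶ P`. -/
def cohomotopyToTotal (n : ℕ) : cohomotopy X F n ⟶ totalCohomology X F n :=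
  HomologicalComplex.homologyMap (resToTotal X F (injectiveResolution F)) n

/-- The map `lim^n F = H^n (lim P) ⟶ H^n` induced by the projections `lim P ⟶ P (X^0)`. -/
def higherLimToTotal [HasLimitsOfShape C AddCommGrpCat.{v}] (n : ℕ) :
    higherLim F n ⟶ totalCohomology X F n :=
  ((injectiveResolution F).isoRightDerivedObj
      (lim : (C ⥤ AddCommGrpCat.{v}) ⥤ AddCommGrpCat.{v}) n).hom ≫
    HomologicalComplex.homologyMap (limToTotal X F (injectiveResolution F)) n

/-- An isomorphism `e : lim^n F ≅ π^n (F X)` is the canonical comparison isomorphism if the map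
`π^n (F X) ⟶ H^n` is invertible and `e` is the map `lim^n F ⟶ H^n` followed by its inverse. -/
def IsCanonicalComparison [HasLimitsOfShape C AddCommGrpCat.{v}] (n : ℕ)
    (e : higherLim F n ≅ cohomotopy X F n) : Prop :=
  IsIso (cohomotopyToTotal X F n) ∧ e.hom ≫ cohomotopyToTotal X F n = higherLimToTotal X F n

end Comparison

/-! ### Higher limits over the categories of presentations -/

section Presentations

variable (ℱ : Pres.{u} ⥤ AddCommGrpCat.{w})

/-- The functor `ℱ` with its values moved to a universe of abelian groups in which all the
categories `Pres(G)` are small, so that limits over `Pres(G)` and their derived functors exist. -/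
abbrev enlarge : Pres.{u} ⥤ AddCommGrpCat.{max w (u + 1)} :=
  ℱ ⋙ AddCommGrpCat.uliftFunctor.{u + 1, w}

/-- The restriction of `ℱ` to `Pres(G)`. -/
abbrev restrict (G : GrpCat.{u}) : PresOver G ⥤ AddCommGrpCat.{max w (u + 1)} :=
  incl G ⋙ enlarge ℱ

/-- The `i`-th higher limit of `ℱ` over `Pres(G)`. -/
abbrev presLim (i : ℕ) (G : GrpCat.{u}) : AddCommGrpCat.{max w (u + 1)} :=
  higherLim (restrict ℱ G) i

/-- The cohomology group `H^i` of `ℱ` applied to the standard complex of `c`. -/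
abbrev presCohomology (i : ℕ) {G : GrpCat.{u}} (c : PresOver G) : AddCommGrpCat.{max w (u + 1)} :=
  cohomotopy (standardComplex c) (restrict ℱ G) i

/-- The map on cohomology induced by the morphism of standard complexes attached to a morphism of
presentations. -/
def presCohomologyMap (i : ℕ) {G G' : GrpCat.{u}} {c : PresOver G} {c' : PresOver G'}
    (f : (incl G).obj c ⟶ (incl G').obj c') : presCohomology ℱ i c ⟶ presCohomology ℱ i c' :=
  HomologicalComplex.homologyMap
    ((AlgebraicTopology.alternatingCofaceMapComplex AddCommGrpCat.{max w (u + 1)}).map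
      (Functor.whiskerRight (standardComplexMap f) (enlarge ℱ))) i

/-- For identifications `e` of the higher limits with the cohomology of the standard complexes,
the homomorphism of higher limits induced by a morphism `f` of presentations. -/
def inducedMap {i : ℕ}
    (e : ∀ (G : GrpCat.{u}) (c : PresOver G), presLim ℱ i G ≅ presCohomology ℱ i c)
    {G G' : GrpCat.{u}} {c : PresOver G} {c' : PresOver G'}
    (f : (incl G).obj c ⟶ (incl G').obj c') : presLim ℱ i G ⟶ presLim ℱ i G' :=
  (e G c).hom ≫ presCohomologyMap ℱ i f ≫ (e G' c').inv

end Presentations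

end

end PresLim

open PresLim

/-!
For an injective functor `P` on `Pres(G)`, the complex of `P` on the standard complex of `c` has
cohomology `lim P`, concentrated in degree `0`. Indeed `P` is a retract of the coinduced functor
`x ↦ ∏_d Map(Hom(x, d), P d)`. As `Hom` from `n + 1` copies of `c` to `d` is `Hom(c, d)^{n+1}`, the
value of the coinduced functor on the standard complex is a product of the cochain complexes of the
nonempty sets `Hom(c, d)`, which are contractible; see `exists_d_eq_of_injective`. In degree `0`, the
limit is the equalizer of the two cofaces; see `exists_limit_π_eq`. Both facts rest on the freeness of
the sources of presentations, which makes all the sets `Hom(c, d)` nonempty.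

For an injective resolution `P^•` of `F`, the double complex `P^q (X^p)` is therefore exact in
positive degrees in both directions, and the complexes `F (X^•)` and `lim P^•` both compute the
cohomology of its total complex. This is `TotalData.isIso_homologyMap`, applied to the double complex
and to its transpose; its proof clears the components of a cocycle one after another. So the
canonical isomorphisms exist.

They are natural for morphisms of cosimplicial objects of `Pres(G)`, since the projections
`lim P ⟶ P (X^0)` are (`comparison_naturality`). Hence morphisms over `G` induce the identity of
`lim^i` (`inducedMap_incl`). Two lifts `f, g : c ⟶ c'` of the same homomorphism are the restrictions
of the lift `(f, g)` on `c ⊔ c` along the two inclusions `c ⟶ c ⊔ c`, which are morphisms over `G`;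
so they induce the same map (`inducedMap_eq_of_parallel`). The case of different presentations
follows by composing with morphisms over `G` and over `G'`, and functoriality follows from that of
the standard complex. Finally, the cohomology of the standard complex is a subquotient of one value of
`ℱ`, which bounds its size.
-/

namespace PresLim

/-! ### Cohomology of complexes of abelian groups by elements -/

section Elements

variable {A B : CochainComplex AddCommGrpCat.{v} ℕ}

theorem exists_cycle {n : ℕ} (a : A.X n) (ha : A.d n (n + 1) a = 0) :
    ∃ z : A.cycles n, A.iCycles n z = a := by
  have ha' : (A.sc n).g a = 0 := by
    change A.d n ((ComplexShape.up ℕ).next n) a = 0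
    rwa [CochainComplex.next]
  exact ⟨(A.sc n).abCyclesIso.inv ⟨a, ha'⟩, (A.sc n).abCyclesIso_inv_apply_iCycles ⟨a, ha'⟩⟩

theorem d_iCycles_apply {n : ℕ} (z : A.cycles n) (m : ℕ) : A.d n m (A.iCycles n z) = 0 := by
  rw [← ConcreteCategory.comp_apply, A.iCycles_d]
  rfl

theorem d_f_apply (f : A ⟶ B) (m n : ℕ) (a : A.X m) : B.d m n (f.f m a) = f.f n (A.d m n a) := by
  rw [← ConcreteCategory.comp_apply, f.comm, ConcreteCategory.comp_apply]

theorem homologyπ_surjective (A : CochainComplex AddCommGrpCat.{v} ℕ) (n : ℕ) :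
    Function.Surjective (A.homologyπ n) :=
  (AddCommGrpCat.epi_iff_surjective _).1 inferInstance

theorem iCycles_injective (A : CochainComplex AddCommGrpCat.{v} ℕ) (n : ℕ) :
    Function.Injective (A.iCycles n) :=
  (AddCommGrpCat.mono_iff_injective _).1 inferInstance

/-- The class of a cycle vanishes if and only if the cycle is a boundary. -/
theorem homologyπ_eq_zero_iff {n : ℕ} (z : A.cycles n) :
    A.homologyπ n z = 0 ↔ ∃ m, ∃ y : A.X m, A.iCycles n z = A.d m n y := by
  constructor
  · intro h
    have hex : (ShortComplex.mk _ _ (A.toCycles_comp_homologyπ _ n)).Exact :=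
      ShortComplex.exact_of_g_is_cokernel _ (A.homologyIsCokernel _ n rfl)
    obtain ⟨y, hy⟩ := (ShortComplex.ab_exact_iff _).1 hex z h
    refine ⟨_, y, ?_⟩
    rw [← A.toCycles_i _ n, ConcreteCategory.comp_apply]
    exact congrArg _ hy.symm
  · rintro ⟨m, y, hy⟩
    have hz : z = A.toCycles m n y := by
      apply iCycles_injective
      rw [hy, ← ConcreteCategory.comp_apply, A.toCycles_i]
    rw [hz, ← ConcreteCategory.comp_apply, A.toCycles_comp_homologyπ]
    rfl

/-- A criterion for a map of complexes to be an isomorphism on cohomology. Boundaries are written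
as `d m n` with `m` arbitrary, so that degree `0` needs no separate treatment: for `m + 1 ≠ n` the
differential is zero. -/
theorem isIso_homologyMap_of_elements (f : A ⟶ B) (n : ℕ)
    (surj : ∀ b : B.X n, B.d n (n + 1) b = 0 → ∃ a : A.X n, A.d n (n + 1) a = 0 ∧
      ∃ m, ∃ b' : B.X m, f.f n a - b = B.d m n b')
    (inj : ∀ a : A.X n, A.d n (n + 1) a = 0 → (∃ m, ∃ b' : B.X m, f.f n a = B.d m n b') →
      ∃ m, ∃ a' : A.X m, a = A.d m n a') :
    IsIso (HomologicalComplex.homologyMap f n) := by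
  rw [ConcreteCategory.isIso_iff_bijective]
  have hπ (z : A.cycles n) : HomologicalComplex.homologyMap f n (A.homologyπ n z) =
      B.homologyπ n (HomologicalComplex.cyclesMap f n z) := by
    rw [← ConcreteCategory.comp_apply, HomologicalComplex.homologyπ_naturality,
      ConcreteCategory.comp_apply]
  have hi (z : A.cycles n) : B.iCycles n (HomologicalComplex.cyclesMap f n z) =
      f.f n (A.iCycles n z) := by
    rw [← ConcreteCategory.comp_apply, HomologicalComplex.cyclesMap_i,
      ConcreteCategory.comp_apply]
  constructor
  · refine (injective_iff_map_eq_zero (HomologicalComplex.homologyMap f n).hom).2 fun x hx => ?_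
    obtain ⟨z, rfl⟩ := homologyπ_surjective A n x
    change HomologicalComplex.homologyMap f n _ = 0 at hx
    rw [hπ, homologyπ_eq_zero_iff, hi] at hx
    exact (homologyπ_eq_zero_iff z).2 (inj _ (d_iCycles_apply z _) hx)
  · intro x
    obtain ⟨z, rfl⟩ := homologyπ_surjective B n x
    obtain ⟨a, ha, m, b', hb⟩ := surj _ (d_iCycles_apply z _)
    obtain ⟨y, rfl⟩ := exists_cycle a ha
    refine ⟨A.homologyπ n y, ?_⟩
    rw [hπ, ← sub_eq_zero, ← map_sub, homologyπ_eq_zero_iff]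
    exact ⟨m, b', by rw [map_sub, hi, hb]⟩

end Elements

/-! ### Double complexes with one exact direction -/

/-- A presentation of a cochain complex of abelian groups as the total complex of a
first-quadrant double complex `K q p`; the signs are absorbed into the differentials `d₁`, `d₂`.
Only the identities used to clear components one after another are recorded, so that a double
complex and its transpose give such data for the same total complex. -/
structure TotalData (T : CochainComplex AddCommGrpCat.{v} ℕ) where
  K : ℕ → ℕ → AddCommGrpCat.{v}
  d₁ (q p : ℕ) : K q p ⟶ K (q + 1) p
  d₂ (q p : ℕ) : K q p ⟶ K q (p + 1)
  ι (q p n : ℕ) (h : q + p = n) : K q p ⟶ T.X n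
  π (q p n : ℕ) (h : q + p = n) : T.X n ⟶ K q p
  ι_π_self (q p n : ℕ) (h : q + p = n) (y : K q p) : π q p n h (ι q p n h y) = y
  ι_π_ne (q p q' p' n : ℕ) (h : q + p = n) (h' : q' + p' = n) (hq : q ≠ q') (y : K q p) :
    π q' p' n h' (ι q p n h y) = 0
  eq_top (n : ℕ) (S : AddSubgroup (T.X n)) (hS : ∀ q p h y, ι q p n h y ∈ S) : S = ⊤
  ι_d (q p n : ℕ) (h : q + p = n) (y : K q p) : T.d n (n + 1) (ι q p n h y) =
    ι (q + 1) p (n + 1) (by omega) (d₁ q p y) + ι q (p + 1) (n + 1) (by omega) (d₂ q p y)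

theorem exists_d_eq_add {A : CochainComplex AddCommGrpCat.{v} ℕ} {m m' : ℕ} (w : A.X m)
    (w' : A.X m') (n : ℕ) : ∃ m'', ∃ w'' : A.X m'', A.d m'' n w'' = A.d m n w + A.d m' n w' := by
  by_cases h : m + 1 = n
  · by_cases h' : m' + 1 = n
    · obtain rfl : m = m' := by omega
      exact ⟨m, w + w', map_add _ _ _⟩
    · exact ⟨m, w, by rw [A.shape _ _ h']; exact (add_zero _).symm⟩
  · exact ⟨m', w', by rw [A.shape _ _ h]; exact (zero_add _).symm⟩

namespace TotalData

variable {T : CochainComplex AddCommGrpCat.{v} ℕ} (D : TotalData T)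

/-- The elements of total degree `n` all of whose components have first degree at most `k`. -/
def fil (k n : ℕ) : AddSubgroup (T.X n) :=
  AddSubgroup.closure {x | ∃ q p, ∃ h : q + p = n, ∃ y, q ≤ k ∧ D.ι q p n h y = x}

variable {D}

theorem ι_mem_fil {k q p n : ℕ} (h : q + p = n) (y : D.K q p) (hq : q ≤ k) :
    D.ι q p n h y ∈ D.fil k n :=
  AddSubgroup.subset_closure ⟨q, p, h, y, hq, rfl⟩

theorem mem_fil_self {n : ℕ} (x : T.X n) : x ∈ D.fil n n := by
  rw [D.eq_top n (D.fil n n) fun q p h y => ι_mem_fil h y (by omega)]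
  trivial

theorem π_eq_zero {k q p n : ℕ} (h : q + p = n) (hq : k < q) {x : T.X n} (hx : x ∈ D.fil k n) :
    D.π q p n h x = 0 := by
  have : D.fil k n ≤ (D.π q p n h).hom.ker := by
    refine (AddSubgroup.closure_le _).2 ?_
    rintro _ ⟨q', p', h', y, hq', rfl⟩
    exact D.ι_π_ne _ _ _ _ _ _ _ (by omega) y
  exact this hx

theorem d_mem_fil {k n : ℕ} {x : T.X n} (hx : x ∈ D.fil k n) :
    T.d n (n + 1) x ∈ D.fil (k + 1) (n + 1) := by
  have : D.fil k n ≤ (D.fil (k + 1) (n + 1)).comap (T.d n (n + 1)).hom := by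
    refine (AddSubgroup.closure_le _).2 ?_
    rintro _ ⟨q', p', h', y, hq', rfl⟩
    change T.d n (n + 1) _ ∈ D.fil _ _
    rw [D.ι_d]
    exact add_mem (ι_mem_fil _ _ (by omega)) (ι_mem_fil _ _ (by omega))
  exact this hx

/-- The component of highest first degree can be split off. -/
theorem exists_eq_add {k p n : ℕ} (h : k + 1 + p = n) {x : T.X n} (hx : x ∈ D.fil (k + 1) n) :
    ∃ x' ∈ D.fil k n, ∃ y, x = x' + D.ι (k + 1) p n h y := by
  have : D.fil (k + 1) n ≤ D.fil k n ⊔ (D.ι (k + 1) p n h).hom.range := by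
    refine (AddSubgroup.closure_le _).2 ?_
    rintro _ ⟨q', p', h', y, hq', rfl⟩
    rcases Nat.lt_or_ge k q' with hlt | hle
    · obtain rfl : q' = k + 1 := by omega
      obtain rfl : p' = p := by omega
      exact AddSubgroup.mem_sup_right ⟨y, rfl⟩
    · exact AddSubgroup.mem_sup_left (ι_mem_fil _ _ hle)
  obtain ⟨x', hx', _, ⟨y, rfl⟩, h'⟩ := AddSubgroup.mem_sup.1 (this hx)
  exact ⟨x', hx', y, h'.symm⟩

theorem exists_of_mem_fil_zero {n : ℕ} {x : T.X n} (hx : x ∈ D.fil 0 n) :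
    ∃ y, x = D.ι 0 n n (zero_add n) y := by
  have : D.fil 0 n ≤ (D.ι 0 n n (zero_add n)).hom.range := by
    refine (AddSubgroup.closure_le _).2 ?_
    rintro _ ⟨q', p', h', y, hq', rfl⟩
    obtain rfl : q' = 0 := by omega
    obtain rfl : p' = n := by omega
    exact ⟨y, rfl⟩
  obtain ⟨y, hy⟩ := this hx
  exact ⟨y, hy.symm⟩

/-- If the double complex is exact in the first direction in positive degrees, an element whose
differential lies in the row `0` can be moved into the row `0` by a boundary. -/
theorem exists_sub_d_mem_fil_zero
    (ex : ∀ q p (y : D.K (q + 1) p), D.d₁ (q + 1) p y = 0 → ∃ z, D.d₁ q p z = y)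
    {k n : ℕ} (hk : k ≤ n) {x : T.X n} (hx : x ∈ D.fil k n)
    (hdx : T.d n (n + 1) x ∈ D.fil 0 (n + 1)) :
    ∃ m, ∃ w : T.X m, x - T.d m n w ∈ D.fil 0 n := by
  induction k generalizing x with
  | zero => exact ⟨n, 0, by simpa using hx⟩
  | succ k ih =>
    obtain ⟨p, hp⟩ := Nat.exists_eq_add_of_le hk
    obtain ⟨x', hx', y, rfl⟩ := exists_eq_add hp.symm hx
    -- In first degree `k + 2`, the differential of `x` has the single contribution `d₁ y`.
    have hy : D.d₁ (k + 1) p y = 0 := by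
      have h := π_eq_zero (q := k + 1 + 1) (p := p) (by omega) (by omega) hdx
      rw [map_add, map_add, π_eq_zero (by omega) (by omega) (d_mem_fil hx'), zero_add, D.ι_d,
        map_add, D.ι_π_self, D.ι_π_ne _ _ _ _ _ _ _ (by omega), add_zero] at h
      exact h
    obtain ⟨z, rfl⟩ := ex _ _ _ hy
    obtain ⟨m, rfl⟩ : ∃ m, n = m + 1 := ⟨k + p, by omega⟩
    have hz := D.ι_d k p m (by omega) z
    have hw : x' + D.ι (k + 1) p (m + 1) hp.symm (D.d₁ k p z) -
        T.d m (m + 1) (D.ι k p m (by omega) z) ∈ D.fil k (m + 1) := by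
      rw [hz, add_comm x', add_sub_add_left_eq_sub]
      exact sub_mem hx' (ι_mem_fil _ _ le_rfl)
    obtain ⟨m', w, h⟩ := ih (by omega) hw (by
      rw [map_sub, ← ConcreteCategory.comp_apply (T.d m (m + 1)), T.d_comp_d]
      simpa using hdx)
    obtain ⟨m'', w'', h''⟩ := exists_d_eq_add (D.ι k p m (by omega) z) w (m + 1)
    exact ⟨m'', w'', by rwa [h'', ← sub_sub]⟩

/-- A double complex whose columns resolve a complex `A`, embedded in the row `0`, has a total
complex with the same cohomology as `A`. -/
theorem isIso_homologyMap (D : TotalData T) {A : CochainComplex AddCommGrpCat.{v} ℕ} (f : A ⟶ T)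
    (φ : ∀ p, A.X p ⟶ D.K 0 p) (hf : ∀ p (a : A.X p), f.f p a = D.ι 0 p p (zero_add p) (φ p a))
    (hφ : ∀ p, Function.Injective (φ p))
    (ex₀ : ∀ p (y : D.K 0 p), D.d₁ 0 p y = 0 → ∃ a, φ p a = y)
    (ex : ∀ q p (y : D.K (q + 1) p), D.d₁ (q + 1) p y = 0 → ∃ z, D.d₁ q p z = y) (n : ℕ) :
    IsIso (HomologicalComplex.homologyMap f n) := by
  have f_inj (p : ℕ) (a : A.X p) (ha : f.f p a = 0) : a = 0 := by
    rw [hf] at ha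
    have h := D.ι_π_self 0 p p (zero_add p) (φ p a)
    rw [ha, map_zero] at h
    exact hφ p (by rw [← h, map_zero])
  -- An element of row `0` whose differential stays in row `0` comes from `A`.
  have of_row (p : ℕ) (x : T.X p) (hx : x ∈ D.fil 0 p)
      (hdx : T.d p (p + 1) x ∈ D.fil 0 (p + 1)) : ∃ a, f.f p a = x := by
    obtain ⟨y, rfl⟩ := exists_of_mem_fil_zero hx
    have h := π_eq_zero (q := 1) (p := p) (by omega) one_pos hdx
    rw [D.ι_d, map_add, D.ι_π_ne 0 _ _ _ _ _ _ (by omega), add_zero] at h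
    obtain ⟨a, rfl⟩ := ex₀ p y ((D.ι_π_self _ _ _ _ _).symm.trans h)
    exact ⟨a, hf p a⟩
  refine isIso_homologyMap_of_elements f n (fun b hb => ?_) ?_
  · obtain ⟨m, w, hw⟩ := exists_sub_d_mem_fil_zero (D := D) ex le_rfl (mem_fil_self b)
      (by rw [hb]; exact zero_mem _)
    have hdw : T.d n (n + 1) (b - T.d m n w) = 0 := by
      rw [map_sub, hb, ← ConcreteCategory.comp_apply, T.d_comp_d]
      exact sub_zero _
    obtain ⟨a, ha⟩ := of_row n _ hw (by rw [hdw]; exact zero_mem _)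
    refine ⟨a, f_inj _ _ ?_, m, -w, ?_⟩
    · rw [← d_f_apply, ha, hdw]
    · rw [ha, map_neg]
      abel
  · rintro a - ⟨m, w, hw⟩
    by_cases hmn : m + 1 = n
    · subst hmn
      have hfa : f.f (m + 1) a ∈ D.fil 0 (m + 1) := by
        rw [hf]
        exact ι_mem_fil _ _ le_rfl
      obtain ⟨l, x, hx⟩ := exists_sub_d_mem_fil_zero (D := D) ex le_rfl (mem_fil_self w)
        (by rwa [← hw])
      have hd : T.d m (m + 1) (w - T.d l m x) = f.f (m + 1) a := by
        rw [map_sub, hw, ← ConcreteCategory.comp_apply, T.d_comp_d]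
        exact sub_zero _
      obtain ⟨a', ha'⟩ := of_row m _ hx (by rwa [hd])
      refine ⟨m, a', sub_eq_zero.1 (f_inj _ _ ?_)⟩
      rw [map_sub, ← d_f_apply, ha', hd, sub_self]
    · rw [T.shape _ _ hmn] at hw
      exact ⟨n, 0, by rw [map_zero]; exact f_inj _ _ hw⟩

end TotalData

/-! ### Rows and columns of a double complex -/

section Transpose

variable (K : HomologicalComplex₂ AddCommGrpCat.{v} (.up ℕ) (.up ℕ))

/-- The projection of the total complex in degree `n` to a component; it is zero if
`q + p ≠ n`. -/
noncomputable def totalπ (q p n : ℕ) : (K.total (.up ℕ)).X n ⟶ (K.X q).X p :=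
  K.totalDesc fun q' p' _ =>
    if h : q' = q ∧ p' = p then eqToHom (by rw [h.1, h.2]) else 0

theorem ιTotal_totalπ_self (q p n : ℕ) (h : q + p = n) (y : (K.X q).X p) :
    totalπ K q p n (K.ιTotal (.up ℕ) q p n h y) = y := by
  rw [← ConcreteCategory.comp_apply, totalπ, K.ι_totalDesc, dif_pos ⟨rfl, rfl⟩]
  rfl

theorem ιTotal_totalπ_ne (q p q' p' n : ℕ) (h : q + p = n) (hq : ¬(q = q' ∧ p = p'))
    (y : (K.X q).X p) :
    totalπ K q' p' n (K.ιTotal (.up ℕ) q p n h y) = 0 := by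
  rw [← ConcreteCategory.comp_apply, totalπ, K.ι_totalDesc, dif_neg hq]
  rfl

/-- The total complex is generated by its components. -/
theorem eq_top_of_ιTotal_mem (n : ℕ) (S : AddSubgroup ((K.total (.up ℕ)).X n))
    (hS : ∀ q p h y, K.ιTotal (.up ℕ) q p n h y ∈ S) : S = ⊤ := by
  have h : AddCommGrpCat.ofHom (QuotientAddGroup.mk' S) = 0 := by
    refine HomologicalComplex₂.total.hom_ext (.up ℕ) fun q p hqp => ?_
    ext y
    exact (QuotientAddGroup.eq_zero_iff _).2 (hS q p hqp y)
  refine (AddSubgroup.eq_top_iff' S).2 fun x => (QuotientAddGroup.eq_zero_iff x).1 ?_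
  exact congrArg (fun t => t.hom x) h

theorem total_d_ιTotal (q p n : ℕ) (h : q + p = n) (y : (K.X q).X p) :
    (K.total (.up ℕ)).d n (n + 1) (K.ιTotal (.up ℕ) q p n h y) =
      K.ιTotal (.up ℕ) (q + 1) p (n + 1) (by change _ + _ = _; omega) ((K.d q (q + 1)).f p y) +
      K.ιTotal (.up ℕ) q (p + 1) (n + 1) (by change _ + _ = _; omega)
        ((((-1 : ℤˣ) ^ q) • (K.X q).d p (p + 1)) y) := by
  have e1 : K.d₁ (.up ℕ) q p (n + 1) = (K.d q (q + 1)).f p ≫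
      K.ιTotal (.up ℕ) (q + 1) p (n + 1) (by change _ + _ = _; omega) := by
    rw [K.d₁_eq (.up ℕ) (show (ComplexShape.up ℕ).Rel q (q + 1) from rfl) p (n + 1)
      (by change _ + _ = _; omega)]
    exact one_smul _ _
  have e2 : K.d₂ (.up ℕ) q p (n + 1) = (((-1 : ℤˣ) ^ q) • (K.X q).d p (p + 1)) ≫
      K.ιTotal (.up ℕ) q (p + 1) (n + 1) (by change _ + _ = _; omega) := by
    rw [K.d₂_eq (.up ℕ) q (show (ComplexShape.up ℕ).Rel p (p + 1) from rfl) (n + 1)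
      (by change _ + _ = _; omega), Linear.units_smul_comp]
    rfl
  have e : K.ιTotal (.up ℕ) q p n h ≫ (K.total (.up ℕ)).d n (n + 1) =
      K.d₁ (.up ℕ) q p (n + 1) + K.d₂ (.up ℕ) q p (n + 1) := by
    change _ ≫ (K.D₁ _ _ _ + K.D₂ _ _ _) = _
    rw [Preadditive.comp_add, K.ι_D₁, K.ι_D₂]
  rw [← ConcreteCategory.comp_apply, e, e1, e2]
  rfl

/-- The total complex of `K`, the first direction being the one to be cleared. -/
noncomputable def rowData : TotalData (K.total (.up ℕ)) where
  K q p := (K.X q).X p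
  d₁ q p := (K.d q (q + 1)).f p
  d₂ q p := ((-1 : ℤˣ) ^ q) • (K.X q).d p (p + 1)
  ι q p n h := K.ιTotal (.up ℕ) q p n h
  π q p n _ := totalπ K q p n
  ι_π_self := ιTotal_totalπ_self K
  ι_π_ne q p q' p' n h _ hq y := ιTotal_totalπ_ne K q p q' p' n h (fun e => hq e.1) y
  eq_top := eq_top_of_ιTotal_mem K
  ι_d := total_d_ιTotal K

/-- The total complex of `K`, the second direction being the one to be cleared. -/
noncomputable def colData : TotalData (K.total (.up ℕ)) where
  K p q := (K.X q).X p
  d₁ p q := ((-1 : ℤˣ) ^ q) • (K.X q).d p (p + 1)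
  d₂ p q := (K.d q (q + 1)).f p
  ι p q n h := K.ιTotal (.up ℕ) q p n ((add_comm q p).trans h)
  π p q n _ := totalπ K q p n
  ι_π_self p q n h := ιTotal_totalπ_self K q p n ((add_comm q p).trans h)
  ι_π_ne p q p' q' n _ _ hq y := ιTotal_totalπ_ne K q p q' p' n _ (fun e => hq e.2) y
  eq_top n S hS := eq_top_of_ιTotal_mem K n S fun q p h => hS p q ((add_comm p q).trans h)
  ι_d p q n h y := (total_d_ιTotal K q p n ((add_comm q p).trans h) y).trans (add_comm _ _)

variable {K}

/-- If every complex `A p ⟶ K 0 p ⟶ K 1 p ⟶ ⋯` is exact, then `A` computes the cohomology of the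
total complex. -/
theorem isIso_homologyMap_rowToTotal (A : CochainComplex AddCommGrpCat.{v} ℕ) (φ : A ⟶ K.X 0)
    (h : φ ≫ K.d 0 1 = 0) (hφ : ∀ p, Function.Injective (φ.f p))
    (ex₀ : ∀ p (y : (K.X 0).X p), (K.d 0 1).f p y = 0 → ∃ a, φ.f p a = y)
    (ex : ∀ q p (y : (K.X (q + 1)).X p), (K.d (q + 1) (q + 2)).f p y = 0 →
      ∃ z, (K.d q (q + 1)).f p z = y) (n : ℕ) :
    IsIso (HomologicalComplex.homologyMap (rowToTotal K A φ h) n) :=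
  (rowData K).isIso_homologyMap _ φ.f (fun _ _ => rfl) hφ ex₀ ex n

theorem units_smul_apply {A B : AddCommGrpCat.{v}} (f : A ⟶ B) (q : ℕ) (y : A) :
    (((-1 : ℤˣ) ^ q) • f) y = f y ∨ (((-1 : ℤˣ) ^ q) • f) y = -f y := by
  rcases neg_one_pow_eq_or ℤˣ q with h | h <;> rw [h]
  · exact Or.inl (by rw [one_smul])
  · exact Or.inr (by rw [Units.neg_smul, one_smul]; rfl)

/-- If every complex `L q ⟶ K q 0 ⟶ K q 1 ⟶ ⋯` is exact, then `L` computes the cohomology of the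
total complex. -/
theorem isIso_homologyMap_colToTotal (L : CochainComplex AddCommGrpCat.{v} ℕ)
    (ψ : ∀ q, L.X q ⟶ (K.X q).X 0)
    (hψ : ∀ q, ψ q ≫ (K.d q (q + 1)).f 0 = L.d q (q + 1) ≫ ψ (q + 1))
    (h : ∀ q, ψ q ≫ (K.X q).d 0 1 = 0) (inj : ∀ q, Function.Injective (ψ q))
    (ex₀ : ∀ q (y : (K.X q).X 0), (K.X q).d 0 1 y = 0 → ∃ a, ψ q a = y)
    (ex : ∀ q p (y : (K.X q).X (p + 1)), (K.X q).d (p + 1) (p + 2) y = 0 →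
      ∃ z, (K.X q).d p (p + 1) z = y) (n : ℕ) :
    IsIso (HomologicalComplex.homologyMap (colToTotal K L ψ hψ h) n) := by
  have aux (q p : ℕ) (y : (K.X q).X p)
      (hy : (((-1 : ℤˣ) ^ q) • (K.X q).d p (p + 1)) y = 0) : (K.X q).d p (p + 1) y = 0 := by
    rcases units_smul_apply ((K.X q).d p (p + 1)) q y with e | e
    · exact e.symm.trans hy
    · exact neg_eq_zero.1 (e.symm.trans hy)
  refine (colData K).isIso_homologyMap _ ψ (fun _ _ => rfl) inj
    (fun q y hy => ex₀ q y (aux q 0 y hy)) (fun p q y hy => ?_) n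
  obtain ⟨z, hz⟩ := ex q p y (aux q (p + 1) y hy)
  rcases units_smul_apply ((K.X q).d p (p + 1)) q z with e | e
  · exact ⟨z, e.trans hz⟩
  · refine ⟨-z, ?_⟩
    change (((-1 : ℤˣ) ^ q) • (K.X q).d p (p + 1)) (-z) = y
    rw [map_neg, e, neg_neg, hz]

end Transpose

/-! ### Lifting homomorphisms to presentations -/

/-- Every homomorphism of groups lifts to any two presentations, because the source of a
presentation is free. -/
theorem exists_lift {G G' : GrpCat.{u}} (c : PresOver G) (c' : PresOver G') (φ : G ⟶ G') :
    ∃ f : (incl G).obj c ⟶ (incl G').obj c', f.base = φ := by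
  have := c.isFree
  choose s hs using c'.surjective
  let t : c.F →* c'.F := IsFreeGroup.lift fun x => s (φ.hom (c.π.hom (IsFreeGroup.of x)))
  refine ⟨⟨GrpCat.ofHom t, φ, GrpCat.hom_ext (IsFreeGroup.ext_hom fun x => ?_)⟩, rfl⟩
  change c'.π.hom (t (IsFreeGroup.of x)) = φ.hom (c.π.hom (IsFreeGroup.of x))
  rw [IsFreeGroup.lift_of, hs]

instance nonempty_hom {G : GrpCat.{u}} (c d : PresOver G) : Nonempty (c ⟶ d) := by
  obtain ⟨f, hf⟩ := exists_lift c d (𝟙 G)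
  exact ⟨⟨f.top, by have := f.w; rwa [hf, Category.comp_id] at this⟩⟩

/-- Every group has a presentation, by the free group on its underlying set. -/
instance nonempty_presOver (G : GrpCat.{u}) : Nonempty (PresOver G) :=
  ⟨{ F := GrpCat.of (FreeGroup G)
     π := GrpCat.ofHom (FreeGroup.lift id)
     isFree := inferInstance
     surjective := fun g => ⟨FreeGroup.of g, by simp⟩ }⟩

/-! ### The coaugmentation is a quasi-isomorphism -/

section Resolution

variable {C : Type u₁} [Category.{v₁} C]

/-- Exactness of functors is pointwise. -/
theorem evaluation_exact {S : ShortComplex (C ⥤ AddCommGrpCat.{v})} (hS : S.Exact) (x : C)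
    (y : S.X₂.obj x) (hy : S.g.app x y = 0) : ∃ z, S.f.app x z = y :=
  (ShortComplex.ab_exact_iff _).1 (hS.map ((evaluation C AddCommGrpCat.{v}).obj x)) y hy

/-- The map `π^n (F X) ⟶ H^n` is invertible for every cosimplicial object `X`, since the values of
an injective resolution at each `X^p` are a resolution of `F (X^p)`. -/
theorem isIso_cohomotopyToTotal (X : CosimplicialObject C) (F : C ⥤ AddCommGrpCat.{v})
    [HasInjectiveResolutions (C ⥤ AddCommGrpCat.{v})] (n : ℕ) :
    IsIso (cohomotopyToTotal X F n) := by
  let P := injectiveResolution F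
  refine isIso_homologyMap_rowToTotal _ _ _ (fun p => ?_) (fun p y hy => ?_) (fun q p y hy => ?_) n
  · have : Mono (coaug P) := inferInstanceAs (Mono (P.ι.f 0))
    exact (AddCommGrpCat.mono_iff_injective ((coaug P).app (X.obj (SimplexCategory.mk p)))).1
      inferInstance
  · exact evaluation_exact P.exact₀ _ y hy
  · exact evaluation_exact (P.exact_succ q) _ y hy

end Resolution

/-! ### Injective functors on the standard complex -/

/-- A cosimplicial abelian group with an extra codegeneracy has no cohomology in positive
degrees. -/
theorem exists_d_eq_of_extraDegeneracy (Y : CosimplicialObject AddCommGrpCat.{v})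
    (h : ∀ n, Y.obj (SimplexCategory.mk (n + 1)) ⟶ Y.obj (SimplexCategory.mk n))
    (h₀ : ∀ n, Y.δ 0 ≫ h n = 𝟙 _)
    (h_succ : ∀ n (i : Fin (n + 2)), Y.δ i.succ ≫ h (n + 1) = h n ≫ Y.δ i)
    (n : ℕ) (y : Y.obj (SimplexCategory.mk (n + 1)))
    (hy : ((AlgebraicTopology.alternatingCofaceMapComplex AddCommGrpCat.{v}).obj Y).d
      (n + 1) (n + 2) y = 0) :
    ((AlgebraicTopology.alternatingCofaceMapComplex AddCommGrpCat.{v}).obj Y).d n (n + 1)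
      (h n y) = y := by
  have hd (m : ℕ) : ((AlgebraicTopology.alternatingCofaceMapComplex AddCommGrpCat.{v}).obj Y).d
      m (m + 1) = AlgebraicTopology.AlternatingCofaceMapComplex.objD Y m :=
    CochainComplex.of_d (fun n => Y.obj (SimplexCategory.mk n))
      (AlgebraicTopology.AlternatingCofaceMapComplex.objD Y) m
  have e : AlgebraicTopology.AlternatingCofaceMapComplex.objD Y (n + 1) ≫ h (n + 1) =
      𝟙 _ - h n ≫ AlgebraicTopology.AlternatingCofaceMapComplex.objD Y n := by
    simp only [AlgebraicTopology.AlternatingCofaceMapComplex.objD]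
    rw [Fin.sum_univ_succ, Preadditive.add_comp, Preadditive.sum_comp, Preadditive.comp_sum,
      sub_eq_add_neg, ← Finset.sum_neg_distrib]
    congr 1
    · simp [h₀]
    · refine Finset.sum_congr rfl fun i _ => ?_
      rw [Preadditive.zsmul_comp, h_succ, Preadditive.comp_zsmul, Fin.val_succ, pow_succ,
        mul_neg_one, neg_smul]
  have e' := ConcreteCategory.congr_hom e y
  rw [hd] at hy ⊢
  have e₀ := (congrArg (h (n + 1)) hy).trans (map_zero _)
  exact (sub_eq_zero.1 (e'.symm.trans e₀)).symm

section Injective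

variable {G : GrpCat.{u}} (P : PresOver G ⥤ AddCommGrpCat.{max w (u + 1)})

/-- The functor `x ↦ ∏_d Map(Hom(x, d), P d)`. It is the product over `d` of the right Kan
extensions of `P d` from `d`. -/
def coinduced : PresOver G ⥤ AddCommGrpCat.{max w (u + 1)} where
  obj x := AddCommGrpCat.of (∀ d : PresOver G, (x ⟶ d) → P.obj d)
  map f := AddCommGrpCat.ofHom
    { toFun := fun α d g => α d (f ≫ g)
      map_zero' := rfl
      map_add' := fun _ _ => rfl }
  map_id x := by
    refine AddCommGrpCat.hom_ext (AddMonoidHom.ext fun α => funext fun d => funext fun g => ?_)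
    exact congrArg (α d) (Category.id_comp g)
  map_comp f f' := by
    refine AddCommGrpCat.hom_ext (AddMonoidHom.ext fun α => funext fun d => funext fun g => ?_)
    exact congrArg (α d) (Category.assoc f f' g)

/-- The embedding of `P` into the coinduced functor. -/
def toCoinduced : P ⟶ coinduced P where
  app x := AddCommGrpCat.ofHom
    { toFun := fun a d g => P.map g a
      map_zero' := by
        funext d g
        exact map_zero _
      map_add' := fun a b => by
        funext d g
        exact map_add _ _ _ }
  naturality x y f := by
    refine AddCommGrpCat.hom_ext (AddMonoidHom.ext fun a => funext fun d => funext fun g => ?_)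
    change P.map g (P.map f a) = P.map (f ≫ g) a
    rw [P.map_comp, ConcreteCategory.comp_apply]

instance mono_toCoinduced : Mono (toCoinduced P) := by
  have (x : PresOver G) : Mono ((toCoinduced P).app x) := by
    refine (AddCommGrpCat.mono_iff_injective _).2 fun a b hab => ?_
    have h : P.map (𝟙 x) a = P.map (𝟙 x) b := congrFun (congrFun hab x) (𝟙 x)
    simpa using h
  exact NatTrans.mono_of_mono_app _

variable (c : PresOver G)

/-- The coface `i` leaves out the copy `i`. -/
theorem standardComplex_δ_desc {d : PresOver G} {n : ℕ} (i : Fin (n + 2))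
    (g : Fin (n + 2) → (c ⟶ d)) :
    (standardComplex c).δ i ≫ copowerDesc (J := Fin (n + 2)) g =
      copowerDesc (J := Fin (n + 1)) (fun j => g (i.succAbove j)) := by
  refine copower_hom_ext (J := Fin (n + 1)) fun j => ?_
  rw [copowerι_desc]
  refine (Category.assoc _ _ _).symm.trans ?_
  exact (congrArg (· ≫ _) (copowerι_desc _ j)).trans (copowerι_desc g (i.succAbove j))

/-- Composition with the morphism from `n + 2` copies of `c` to `d` that is a fixed morphism on
the copy `0` and a given one on the others. -/
noncomputable def coinducedExtra (n : ℕ) :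
    (coinduced P).obj ((standardComplex c).obj (SimplexCategory.mk (n + 1))) ⟶
      (coinduced P).obj ((standardComplex c).obj (SimplexCategory.mk n)) :=
  AddCommGrpCat.ofHom
    { toFun := fun α d f => α d (copowerDesc (J := Fin (n + 2))
        (Fin.cons (Classical.arbitrary (c ⟶ d)) fun j => copowerι c (Fin (n + 1)) j ≫ f))
      map_zero' := rfl
      map_add' := fun _ _ => rfl }

theorem coinduced_δ_zero (n : ℕ) : CosimplicialObject.δ (standardComplex c ⋙ coinduced P) 0 ≫
    coinducedExtra P c n = 𝟙 _ := by
  refine AddCommGrpCat.hom_ext (AddMonoidHom.ext fun α => funext fun d => funext fun f => ?_)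
  refine congrArg (α d) ?_
  refine (standardComplex_δ_desc c 0 _).trans ?_
  refine copower_hom_ext (J := Fin (n + 1)) fun j => ?_
  rw [copowerι_desc]
  rfl

theorem coinduced_δ_succ (n : ℕ) (i : Fin (n + 2)) :
    CosimplicialObject.δ (standardComplex c ⋙ coinduced P) i.succ ≫ coinducedExtra P c (n + 1) =
      coinducedExtra P c n ≫ CosimplicialObject.δ (standardComplex c ⋙ coinduced P) i := by
  refine AddCommGrpCat.hom_ext (AddMonoidHom.ext fun α => funext fun d => funext fun f => ?_)
  refine congrArg (α d) ?_
  refine (standardComplex_δ_desc c i.succ _).trans ?_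
  refine congrArg (copowerDesc (J := Fin (n + 2))) (funext fun j => ?_)
  refine Fin.cases ?_ (fun j => ?_) j
  · rfl
  · rw [Fin.succ_succAbove_succ, Fin.cons_succ, Fin.cons_succ]
    refine Eq.trans ?_ (Category.assoc _ _ _)
    exact (congrArg (· ≫ f) (copowerι_desc (J := Fin (n + 1))
      (fun j => copowerι c (Fin (n + 2)) (i.succAbove j)) j)).symm

/-- An injective functor has no cohomology in positive degrees on the standard complex, being a
retract of the coinduced functor. -/
theorem exists_d_eq_of_injective [Injective P] (p : ℕ)
    (y : ((evalComplex (standardComplex c)).obj P).X (p + 1))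
    (hy : ((evalComplex (standardComplex c)).obj P).d (p + 1) (p + 2) y = 0) :
    ∃ z, ((evalComplex (standardComplex c)).obj P).d p (p + 1) z = y := by
  let r : coinduced P ⟶ P := Injective.factorThru (𝟙 P) (toCoinduced P)
  have hr : toCoinduced P ≫ r = 𝟙 P := Injective.comp_factorThru _ _
  let I := (evalComplex (standardComplex c)).map (toCoinduced P)
  let R := (evalComplex (standardComplex c)).map r
  have hIR : I ≫ R = 𝟙 _ :=
    ((evalComplex (standardComplex c)).map_comp _ _).symm.trans
      ((congrArg _ hr).trans ((evalComplex (standardComplex c)).map_id _))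
  have hI : ((evalComplex (standardComplex c)).obj (coinduced P)).d (p + 1) (p + 2)
      (I.f (p + 1) y) = 0 := by
    rw [d_f_apply, hy, map_zero]
  have h := exists_d_eq_of_extraDegeneracy (standardComplex c ⋙ coinduced P) (coinducedExtra P c)
    (coinduced_δ_zero P c) (coinduced_δ_succ P c) p (I.f (p + 1) y) hI
  refine ⟨R.f p (coinducedExtra P c p (I.f (p + 1) y)), ?_⟩
  refine (d_f_apply R p (p + 1) _).trans ((congrArg (R.f (p + 1)) h).trans ?_)
  exact congrArg (fun t => AddCommGrpCat.Hom.hom (HomologicalComplex.Hom.f t (p + 1)) y) hIR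

end Injective

section Limit

variable {G : GrpCat.{u}} (c : PresOver G) (P : PresOver G ⥤ AddCommGrpCat.{max w (u + 1)})

/-- Every presentation is weakly initial in `Pres(G)`, so an element of the limit is determined by
any one of its components. -/
theorem limit_π_injective (x : PresOver G) : Function.Injective (limit.π P x) := by
  refine (injective_iff_map_eq_zero (limit.π P x).hom).2 fun a ha => ?_
  refine Concrete.limit_ext P _ _ fun d => ?_
  have f : x ⟶ d := Classical.arbitrary _
  rw [← limit.w P f, ConcreteCategory.comp_apply, ConcreteCategory.comp_apply]
  exact congrArg _ (ha.trans (map_zero _).symm)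

/-- The limit of `P` is the equalizer of the two cofaces: an element on which they agree has the
same image under any two morphisms `f, g` to `d`, because `f` and `g` are the restrictions along the
cofaces of one morphism from two copies of `c` to `d`. -/
theorem exists_limit_π_eq (y : P.obj ((standardComplex c).obj (SimplexCategory.mk 0)))
    (hy : ((evalComplex (standardComplex c)).obj P).d 0 1 y = 0) :
    ∃ a, limit.π P ((standardComplex c).obj (SimplexCategory.mk 0)) a = y := by
  let x := (standardComplex c).obj (SimplexCategory.mk 0)
  let E : AddSubgroup (P.obj x) := (((evalComplex (standardComplex c)).obj P).d 0 1).hom.ker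
  have hE (a : E) {d : PresOver G} (f g : x ⟶ d) : P.map f a.1 = P.map g a.1 := by
    let k : (standardComplex c).obj (SimplexCategory.mk 1) ⟶ d :=
      copowerDesc (J := Fin 2) ![copowerι c (Fin 1) 0 ≫ f, copowerι c (Fin 1) 0 ≫ g]
    have hf : (standardComplex c).δ 1 ≫ k = f := by
      refine (standardComplex_δ_desc c 1 _).trans (copower_hom_ext (J := Fin 1) fun j => ?_)
      rw [copowerι_desc, Subsingleton.elim j 0]
      rfl
    have hg : (standardComplex c).δ 0 ≫ k = g := by
      refine (standardComplex_δ_desc c 0 _).trans (copower_hom_ext (J := Fin 1) fun j => ?_)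
      rw [copowerι_desc, Subsingleton.elim j 0]
      rfl
    have ha : ((evalComplex (standardComplex c)).obj P).d 0 1 a.1 = 0 := a.2
    have hd : ((evalComplex (standardComplex c)).obj P).d 0 1 =
        P.map ((standardComplex c).δ 0) - P.map ((standardComplex c).δ 1) :=
      alternatingCoface_d_zero (standardComplex c ⋙ P)
    rw [hd] at ha
    have ha' : P.map ((standardComplex c).δ 0) a.1 = P.map ((standardComplex c).δ 1) a.1 :=
      sub_eq_zero.1 ha
    rw [← hf, ← hg, P.map_comp, P.map_comp, ConcreteCategory.comp_apply,
      ConcreteCategory.comp_apply, ha']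
  let s : Cone P :=
    { pt := AddCommGrpCat.of E
      π :=
        { app := fun d => AddCommGrpCat.ofHom
            ((P.map (Classical.arbitrary (x ⟶ d))).hom.comp E.subtype)
          naturality := fun d d' f => by
            ext a
            refine (hE a (Classical.arbitrary (x ⟶ d')) (Classical.arbitrary (x ⟶ d) ≫ f)).trans ?_
            rw [P.map_comp]
            rfl } }
  refine ⟨limit.lift P s ⟨y, hy⟩, ?_⟩
  rw [← ConcreteCategory.comp_apply, limit.lift_π]
  refine (hE ⟨y, hy⟩ _ (𝟙 x)).trans ?_
  rw [P.map_id]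
  rfl

/-- The map `lim^n P ⟶ H^n` is invertible, since each injective functor `I` in a resolution has
`lim I` as the only cohomology of its values on the standard complex. -/
theorem isIso_higherLimToTotal (n : ℕ) :
    IsIso (higherLimToTotal (standardComplex c) P n) := by
  have : IsIso (HomologicalComplex.homologyMap
      (limToTotal (standardComplex c) P (injectiveResolution P)) n) :=
    isIso_homologyMap_colToTotal _ _ _ _ (fun q => limit_π_injective _ _)
      (fun q y hy => exists_limit_π_eq c _ y hy)
      (fun q p y hy => exists_d_eq_of_injective _ c p y hy) n
  exact IsIso.comp_isIso' inferInstance this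

end Limit

/-! ### Naturality of the comparison in the cosimplicial object -/

section Naturality

variable {C : Type u₁} [Category.{v₁} C] {X Y : CosimplicialObject C} (t : X ⟶ Y)

/-- The morphism of alternating sum complexes induced by a morphism of cosimplicial objects. -/
noncomputable abbrev evalComplexMap : evalComplex.{v} X ⟶ evalComplex.{v} Y :=
  Functor.whiskerRight
    ((Functor.whiskeringLeft SimplexCategory C AddCommGrpCat.{v}).map t)
    (AlgebraicTopology.alternatingCofaceMapComplex AddCommGrpCat.{v})

/-- The morphism of total complexes induced by a morphism of cosimplicial objects. -/
noncomputable def totalComplexMap (P : CochainComplex (C ⥤ AddCommGrpCat.{v}) ℕ) :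
    totalComplex X P ⟶ totalComplex Y P :=
  HomologicalComplex₂.total.map
    ((NatTrans.mapHomologicalComplex (evalComplexMap t) (.up ℕ)).app P) (.up ℕ)

theorem resToTotal_naturality (F : C ⥤ AddCommGrpCat.{v}) (P : InjectiveResolution F) :
    resToTotal X F P ≫ totalComplexMap t P.cocomplex =
      (evalComplexMap t).app F ≫ resToTotal Y F P := by
  refine HomologicalComplex.hom_ext _ _ fun p => ?_
  have h := congrArg (fun s => HomologicalComplex.Hom.f s p)
    ((evalComplexMap.{v} t).naturality (coaug P))
  change (((evalComplex X).map (coaug P)).f p ≫ _) ≫ _ =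
    ((evalComplexMap t).app F).f p ≫ ((evalComplex Y).map (coaug P)).f p ≫ _
  refine (Category.assoc _ _ _).trans ?_
  refine (congrArg (((evalComplex X).map (coaug P)).f p ≫ ·)
    (HomologicalComplex₂.ιTotal_map _ _ ((NatTrans.mapHomologicalComplex (evalComplexMap t)
      (.up ℕ)).app P.cocomplex) (.up ℕ) 0 p p (zero_add p))).trans ?_
  refine (Category.assoc _ _ _).symm.trans (Eq.trans ?_ (Category.assoc _ _ _))
  exact congrArg (· ≫ _) h

theorem limToTotal_naturality (F : C ⥤ AddCommGrpCat.{v}) (P : InjectiveResolution F)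
    [HasLimitsOfShape C AddCommGrpCat.{v}] :
    limToTotal X F P ≫ totalComplexMap t P.cocomplex = limToTotal Y F P := by
  refine HomologicalComplex.hom_ext _ _ fun q => ?_
  change (limit.π (P.cocomplex.X q) (X.obj (SimplexCategory.mk 0)) ≫ _) ≫ _ =
    limit.π (P.cocomplex.X q) (Y.obj (SimplexCategory.mk 0)) ≫ _
  refine (Category.assoc _ _ _).trans ?_
  refine (congrArg (limit.π (P.cocomplex.X q) (X.obj (SimplexCategory.mk 0)) ≫ ·)
    (HomologicalComplex₂.ιTotal_map _ _ ((NatTrans.mapHomologicalComplex (evalComplexMap t)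
      (.up ℕ)).app P.cocomplex) (.up ℕ) q 0 q (add_zero q))).trans ?_
  refine (Category.assoc _ _ _).symm.trans ?_
  exact congrArg (· ≫ _) (limit.w (P.cocomplex.X q) (t.app (SimplexCategory.mk 0)))

end Naturality

/-! ### The canonical isomorphism -/

section Canonical

variable {G : GrpCat.{u}} (F : PresOver G ⥤ AddCommGrpCat.{max w (u + 1)})

/-- The canonical isomorphism `lim^n F ≅ π^n (F X)` for the standard complex `X` of `c`. -/
noncomputable def comparison (n : ℕ) (c : PresOver G) :
    higherLim F n ≅ cohomotopy (standardComplex c) F n :=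
  have := isIso_cohomotopyToTotal (standardComplex c) F n
  have := isIso_higherLimToTotal c F n
  asIso (higherLimToTotal (standardComplex c) F n) ≪≫
    (asIso (cohomotopyToTotal (standardComplex c) F n)).symm

theorem isCanonicalComparison (n : ℕ) (c : PresOver G) :
    IsCanonicalComparison (standardComplex c) F n (comparison F n c) := by
  have := isIso_cohomotopyToTotal (standardComplex c) F n
  refine ⟨this, ?_⟩
  simp [comparison]

/-- The projections `lim P ⟶ P (X^0)` are compatible with every morphism of cosimplicial objects of
`Pres(G)`; hence so are the canonical isomorphisms. -/
theorem comparison_naturality (n : ℕ) {c c' : PresOver G}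
    (t : standardComplex c ⟶ standardComplex c') :
    (comparison F n c).hom ≫
      HomologicalComplex.homologyMap ((evalComplexMap t).app F) n = (comparison F n c').hom := by
  have := isIso_cohomotopyToTotal (standardComplex c') F n
  let P := injectiveResolution F
  have h1 : cohomotopyToTotal (standardComplex c) F n ≫
      HomologicalComplex.homologyMap (totalComplexMap t P.cocomplex) n =
      HomologicalComplex.homologyMap ((evalComplexMap t).app F) n ≫
        cohomotopyToTotal (standardComplex c') F n := by
    refine (HomologicalComplex.homologyMap_comp _ _ _).symm.trans ?_
    refine (congrArg (fun s => HomologicalComplex.homologyMap s n)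
      (resToTotal_naturality t F P)).trans ?_
    exact HomologicalComplex.homologyMap_comp _ _ _
  have h2 : higherLimToTotal (standardComplex c) F n ≫
      HomologicalComplex.homologyMap (totalComplexMap t P.cocomplex) n =
      higherLimToTotal (standardComplex c') F n := by
    refine (Category.assoc _ _ _).trans (congrArg (_ ≫ ·) ?_)
    refine (HomologicalComplex.homologyMap_comp _ _ _).symm.trans ?_
    exact congrArg (fun s => HomologicalComplex.homologyMap s n) (limToTotal_naturality t F P)
  rw [← cancel_mono (cohomotopyToTotal (standardComplex c') F n), Category.assoc, ← h1,
    (isCanonicalComparison F n c').2, ← Category.assoc, (isCanonicalComparison F n c).2, h2]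

end Canonical

/-! ### Independence of the presentations and the lift -/

section Induced

/-- The morphism of standard complexes induced by a morphism over `G`. -/
noncomputable def standardComplexMapOver {G : GrpCat.{u}} {c c' : PresOver G} (f : c ⟶ c') :
    standardComplex c ⟶ standardComplex c' where
  app n := copowerDesc fun j => f ≫ copowerι c' (Fin (n.len + 1)) j
  naturality n m g := copower_hom_ext (J := Fin (n.len + 1)) fun j => by
    refine (Category.assoc _ _ _).symm.trans (Eq.trans ?_ (Category.assoc _ _ _))
    refine (congrArg (· ≫ _) (copowerι_desc (J := Fin (n.len + 1)) _ j)).trans ?_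
    refine (copowerι_desc (J := Fin (m.len + 1)) _ (g.toOrderHom j)).trans ?_
    refine Eq.trans ?_ (congrArg (· ≫ _) (copowerι_desc (J := Fin (n.len + 1)) _ j).symm)
    refine Eq.trans ?_ (Category.assoc _ _ _).symm
    exact congrArg (f ≫ ·) (copowerι_desc (J := Fin (n.len + 1))
      (fun j => copowerι c' (Fin (m.len + 1)) (g.toOrderHom j)) j).symm

theorem standardComplexMap_incl {G : GrpCat.{u}} {c c' : PresOver G} (f : c ⟶ c') :
    standardComplexMap ((incl G).map f) =
      Functor.whiskerRight (standardComplexMapOver f) (incl G) := by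
  ext n
  rfl

theorem standardComplexMap_comp {G G' G'' : GrpCat.{u}} {c : PresOver G} {c' : PresOver G'}
    {c'' : PresOver G''} (f : (incl G).obj c ⟶ (incl G').obj c')
    (g : (incl G').obj c' ⟶ (incl G'').obj c'') :
    standardComplexMap (f ≫ g) = standardComplexMap f ≫ standardComplexMap g := by
  refine NatTrans.ext (funext fun n => Pres.Hom.ext ?_ rfl)
  refine GrpCat.hom_ext (Monoid.CoprodI.ext_hom _ _ fun j => ?_)
  ext x
  -- A map of standard complexes sends the element `y` of the copy `j` to the image of `y` in the
  -- copy `j`.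
  have h {H H' : GrpCat.{u}} {d : PresOver H} {d' : PresOver H'}
      (k : (incl H).obj d ⟶ (incl H').obj d') (y : d.F) :
      ((standardComplexMap k).app n).top.hom (Monoid.CoprodI.of
        (M := fun _ : Fin (n.len + 1) => d.F) (i := j) y) =
      Monoid.CoprodI.of (M := fun _ : Fin (n.len + 1) => d'.F) (i := j) (k.top.hom y) := by
    refine (Monoid.CoprodI.lift_of _ _).trans ?_
    rfl
  exact (h (f ≫ g) x).trans ((h g (f.top.hom x)).symm.trans
    (congrArg ((standardComplexMap g).app n).top.hom (h f x).symm))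

variable (ℱ : Pres.{u} ⥤ AddCommGrpCat.{w}) (i : ℕ)

theorem presCohomologyMap_comp {G G' G'' : GrpCat.{u}} {c : PresOver G} {c' : PresOver G'}
    {c'' : PresOver G''} (f : (incl G).obj c ⟶ (incl G').obj c')
    (g : (incl G').obj c' ⟶ (incl G'').obj c'') :
    presCohomologyMap ℱ i (f ≫ g) = presCohomologyMap ℱ i f ≫ presCohomologyMap ℱ i g := by
  refine Eq.trans ?_ (HomologicalComplex.homologyMap_comp _ _ _)
  refine congrArg (fun s => HomologicalComplex.homologyMap s i) ?_
  refine Eq.trans ?_ (Functor.map_comp _ _ _)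
  refine congrArg (AlgebraicTopology.alternatingCofaceMapComplex _).map ?_
  refine Eq.trans ?_ (Functor.whiskerRight_comp _ _ _)
  exact congrArg (fun s => Functor.whiskerRight s (enlarge ℱ)) (standardComplexMap_comp f g)

/-- The canonical isomorphisms for the restrictions of `ℱ` to the categories `Pres(G)`. -/
noncomputable abbrev presComparison (G : GrpCat.{u}) (c : PresOver G) :
    presLim ℱ i G ≅ presCohomology ℱ i c :=
  comparison (restrict ℱ G) i c

/-- A morphism over `G` induces the identity of `lim^i`. -/
theorem inducedMap_incl {G : GrpCat.{u}} {c c' : PresOver G} (f : c ⟶ c') :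
    inducedMap ℱ (presComparison ℱ i) ((incl G).map f) = 𝟙 _ := by
  have h : presCohomologyMap ℱ i ((incl G).map f) =
      HomologicalComplex.homologyMap
        ((evalComplexMap (standardComplexMapOver f)).app (restrict ℱ G)) i := by
    unfold presCohomologyMap
    rw [standardComplexMap_incl]
    rfl
  unfold inducedMap
  rw [h, ← Category.assoc, comparison_naturality, Iso.hom_inv_id]

theorem inducedMap_comp {G G' G'' : GrpCat.{u}} {c : PresOver G} {c' : PresOver G'}
    {c'' : PresOver G''} (f : (incl G).obj c ⟶ (incl G').obj c')
    (g : (incl G').obj c' ⟶ (incl G'').obj c'') :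
    inducedMap ℱ (presComparison ℱ i) (f ≫ g) =
      inducedMap ℱ (presComparison ℱ i) f ≫ inducedMap ℱ (presComparison ℱ i) g := by
  simp [inducedMap, presCohomologyMap_comp]

/-- Two lifts `c ⟶ c'` of the same homomorphism induce the same map: they are the restrictions of
one lift, defined on the coproduct of two copies of `c`, along the two inclusions, and both
inclusions are morphisms over `G`. -/
theorem inducedMap_eq_of_parallel {G G' : GrpCat.{u}} {c : PresOver G} {c' : PresOver G'}
    (f g : (incl G).obj c ⟶ (incl G').obj c') (h : f.base = g.base) :
    inducedMap ℱ (presComparison ℱ i) f = inducedMap ℱ (presComparison ℱ i) g := by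
  let s : Fin 2 → ((incl G).obj c ⟶ (incl G').obj c') := ![f, g]
  have hs (j : Fin 2) : (s j).base = f.base := by
    fin_cases j
    · rfl
    · exact h.symm
  let k : (incl G).obj (copower c (Fin 2)) ⟶ (incl G').obj c' :=
    { top := GrpCat.ofHom (Monoid.CoprodI.lift fun j => (s j).top.hom)
      base := f.base
      w := by
        refine GrpCat.hom_ext (Monoid.CoprodI.ext_hom _ _ fun j => ?_)
        ext x
        have hw : c'.π.hom ((s j).top.hom x) = (s j).base.hom (c.π.hom x) :=
          congrArg (fun t => t.hom x) (s j).w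
        rw [hs] at hw
        change c'.π.hom (Monoid.CoprodI.lift (fun j => (s j).top.hom) (Monoid.CoprodI.of x)) =
          f.base.hom (Monoid.CoprodI.lift (fun _ : Fin 2 => c.π.hom) (Monoid.CoprodI.of x))
        rw [Monoid.CoprodI.lift_of, Monoid.CoprodI.lift_of, hw] }
  have hk (j : Fin 2) : (incl G).map (copowerι c (Fin 2) j) ≫ k = s j := by
    refine Pres.Hom.ext (GrpCat.hom_ext ?_) ((Category.id_comp f.base).trans (hs j).symm)
    ext x
    change Monoid.CoprodI.lift (fun j => (s j).top.hom) (Monoid.CoprodI.of x) = _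
    rw [Monoid.CoprodI.lift_of]
  have hind (j : Fin 2) : inducedMap ℱ (presComparison ℱ i) (s j) =
      inducedMap ℱ (presComparison ℱ i) k := by
    rw [← hk j, inducedMap_comp, inducedMap_incl, Category.id_comp]
  exact (hind 0).trans (hind 1).symm

theorem inducedMap_eq {G G' : GrpCat.{u}} {c₁ c₂ : PresOver G} {c₁' c₂' : PresOver G'}
    (f₁ : (incl G).obj c₁ ⟶ (incl G').obj c₁') (f₂ : (incl G).obj c₂ ⟶ (incl G').obj c₂')
    (h : f₁.base = f₂.base) :
    inducedMap ℱ (presComparison ℱ i) f₁ = inducedMap ℱ (presComparison ℱ i) f₂ := by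
  let g : c₁ ⟶ c₂ := Classical.arbitrary _
  let g' : c₁' ⟶ c₂' := Classical.arbitrary _
  have e := inducedMap_eq_of_parallel ℱ i (f₁ ≫ (incl G').map g') ((incl G).map g ≫ f₂)
    ((Category.comp_id f₁.base).trans (h.trans (Category.id_comp f₂.base).symm))
  rwa [inducedMap_comp, inducedMap_comp, inducedMap_incl, inducedMap_incl, Category.comp_id,
    Category.id_comp] at e

/-- The functor `G ↦ lim^i ℱ` on groups. A homomorphism acts through an arbitrary lift to
arbitrary presentations; the functor laws hold because the lift does not matter. -/
noncomputable def presLimFunctor : GrpCat.{u} ⥤ AddCommGrpCat.{max w (u + 1)} where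
  obj G := presLim ℱ i G
  map {G G'} φ := inducedMap ℱ (presComparison ℱ i)
    (exists_lift (Classical.arbitrary (PresOver G)) (Classical.arbitrary (PresOver G')) φ).choose
  map_id G := by
    rw [← inducedMap_incl ℱ i (𝟙 (Classical.arbitrary (PresOver G)))]
    exact inducedMap_eq ℱ i _ _ (exists_lift _ _ _).choose_spec
  map_comp φ ψ := by
    rw [← inducedMap_comp]
    refine inducedMap_eq ℱ i _ _ ((exists_lift _ _ _).choose_spec.trans ?_)
    exact congrArg₂ (· ≫ ·) (exists_lift _ _ φ).choose_spec.symm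
      (exists_lift _ _ ψ).choose_spec.symm

end Induced

/-! ### Size -/

theorem small_homology (A : CochainComplex AddCommGrpCat.{v} ℕ) (n : ℕ) [Small.{w} (A.X n)] :
    Small.{w} (A.homology n) :=
  have : Small.{w} (A.cycles n) := small_of_injective (iCycles_injective A n)
  small_of_surjective (homologyπ_surjective A n)

theorem small_presCohomology (ℱ : Pres.{u} ⥤ AddCommGrpCat.{w}) (i : ℕ) {G : GrpCat.{u}}
    (c : PresOver G) : Small.{w} (presCohomology ℱ i c) :=
  have : Small.{w} (((evalComplex (standardComplex c)).obj (restrict ℱ G)).X i) :=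
    inferInstanceAs (Small.{w} (ULift.{u + 1, w}
      (ℱ.obj ((incl G).obj ((standardComplex c).obj (SimplexCategory.mk i))))))
  small_homology _ i

end PresLim

theorem lemma4p1 (ℱ : Pres.{u} ⥤ AddCommGrpCat.{w}) (i : ℕ) :
    ∃ e : ∀ (G : GrpCat.{u}) (c : PresOver G), presLim ℱ i G ≅ presCohomology ℱ i c,
      (∀ (G : GrpCat.{u}) (c : PresOver G),
        IsCanonicalComparison (standardComplex c) (restrict ℱ G) i (e G c)) ∧
      (∀ (G G' : GrpCat.{u}) (φ : G ⟶ G') (c₁ c₂ : PresOver G) (c₁' c₂' : PresOver G')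
        (f₁ : (incl G).obj c₁ ⟶ (incl G').obj c₁') (f₂ : (incl G).obj c₂ ⟶ (incl G').obj c₂'),
        f₁.base = φ → f₂.base = φ → inducedMap ℱ e f₁ = inducedMap ℱ e f₂) ∧
      (∃! L : GrpCat.{u} ⥤ AddCommGrpCat.{max w (u + 1)},
        ∃ hL : ∀ G : GrpCat.{u}, L.obj G = presLim ℱ i G,
          ∀ (G G' : GrpCat.{u}) (c : PresOver G) (c' : PresOver G')
            (f : (incl G).obj c ⟶ (incl G').obj c'),
            L.map f.base =
              eqToHom (hL G) ≫ inducedMap ℱ e f ≫ eqToHom (hL G').symm) ∧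
      (∀ G : GrpCat.{u}, Small.{w} (presLim ℱ i G)) := by
  refine ⟨presComparison ℱ i, fun G c => isCanonicalComparison _ _ _,
    fun G G' φ c₁ c₂ c₁' c₂' f₁ f₂ h₁ h₂ => inducedMap_eq ℱ i f₁ f₂ (h₁.trans h₂.symm),
    ⟨presLimFunctor ℱ i, ⟨fun G => rfl, fun G G' c c' f => ?_⟩, ?_⟩, fun G => ?_⟩
  · refine Eq.trans ?_ ((Category.id_comp _).trans (Category.comp_id _)).symm
    exact inducedMap_eq ℱ i _ _ (exists_lift _ _ _).choose_spec
  · rintro L ⟨hL, hmap⟩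
    refine CategoryTheory.Functor.ext hL fun G G' φ => ?_
    let c : PresOver G := Classical.arbitrary _
    let c' : PresOver G' := Classical.arbitrary _
    have h := hmap G G' c c' (exists_lift c c' φ).choose
    rw [(exists_lift c c' φ).choose_spec] at h
    exact h
  · let c : PresOver G := Classical.arbitrary _
    have := small_presCohomology ℱ i c
    exact small_of_injective
      ((ConcreteCategory.isIso_iff_bijective (presComparison ℱ i G c).hom).1 inferInstance).1
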